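/- Let $n,m\ge 0$ be integers, $D>0$, and let $f:\mathbb R^n\times\mathbb R^m\to\mathbb R^n$ be such that * (Lipschitz dynamics) for all compact sets $A\subset\mathbb R^n$, $B\subset\mathbb R^m$ there is a constant $C_f=C_f(A,B)>0$ with $|f(x_1,u_1)-f(x_2,u_2)|\le C_f(|x_1-x_2|+|u_1-u_2|)$ for all $x_1,x_2\in A$, $u_1,u_2\in B$; * (forward completeness) for every $x_0\in\mathbb R^n$ and every continuous input $\omega$, the system $\dot X=f(X,\omega)$, $X(0)=x_0$, has a solution on $[0,\infty)$. For $X\in\mathbb R^n$ and $U\in C^1([-D,0];\mathbb R^m)$ let $P=\mathcal P(X,U)\in C^1([-D,0];\mathbb R^n)$ be the solution of $$P(s)-\int_{-D}^s f(P(\theta),U(\theta))\,d\theta-X=0,\qquad s\in[-D,0].$$ Let $\sigma:\mathbb R\to\mathbb R$ be an infinitely differentiable activation function that is not a polynomial. A *neural network* is a finite composition of affine maps with $\sigma$ applied componentwise between them. A *neural operator* (nonlocal neural operator with activation $\sigma$ on $[-D,0]$) is a map $\mathcal Q\circ\mathcal L_L\circ\cdots\circ\mathcal L_1\circ\mathcal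 R$, $L\ge1$, with a channel dimension $d_c\ge1$, where $(\mathcal R c)(x)=R(c(x),x)$ and $(\mathcal Q v)(y)=Q(v(y),y)$ for neural networks $R,Q$ with values in $\mathbb R^{d_c}$ and $\mathbb R^n$ respectively, and $$(\mathcal L_l v)(x)=\sigma\Big(W_l v(x)+b_l+\int_{-D}^0 K_l(x,y)v(y)\,dy\Big)$$ with $W_l\in\mathbb R^{d_c\times d_c}$, $b_l\in\mathbb R^{d_c}$, $\sigma$ acting componentwise, and a kernel $K_l(x,y)\in\mathbb R^{d_c\times d_c}$ whose entries are neural networks in $(x,y)$. It is applied to a pair $(X,U)$ through the input function $c(x)=(X,U(x))\in\mathbb R^{n+m}$, $x\in[-D,0]$. **Theorem.** The predictor operator $\mathcal P:\mathbb R^n\times C^1([-D,0];\mathbb R^m)\to C^1([-D,0];\mathbb R^n)$ is well defined, that is, the equation above has exactly one solution $P\in C^1([-D,0];\mathbb R^n)$ for every $(X,U)$. Moreover, let $\mathcal X\subset\mathbb R^n$ and $\mathcal U\subset\mathbb R^m$ be bounded, and let $K\subset\mathcal X\times C^1([-D,0];\mathcal U)$ be compact with respect to the Euclidean norm on $\mathbb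 R^n$ and the uniform norm on $C^1([-D,0];\mathbb R^m)$ (in particular, $K$ may be any set that is compact with respect to the $C^1$ norm). Then for every $\varepsilon>0$ there is a neural operator $\hat{\mathcal P}:K\to C^1([-D,0];\mathbb R^n)$ with activation $\sigma$ such that $$\sup_{(X,U)\in K}\ \sup_{\theta\in[-D,0]}\big|\mathcal P(X,U)(\theta)-\hat{\mathcal P}(X,U)(\theta)\big|<\varepsilon .$$ -/

import Mathlib

open Set MeasureTheory
open scoped ContDiff

noncomputable section

namespace DelayPredictor

/-- `ℝᵏ` with the Euclidean norm. -/
abbrev Vec (k : ℕ) : Type := EuclideanSpace ℝ (Fin k)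

/-- `C¹([-D, 0]; ℝᵏ)`: continuous functions on `[-D, 0]` that are continuously differentiable
there (one-sided at the endpoints).  As a subtype of `C([-D, 0], ℝᵏ)` it carries the topology of
the uniform norm.  Every set that is compact for the `C¹` norm is compact for this topology. -/
abbrev C1 (D : ℝ) (k : ℕ) : Type :=
  {U : C(Icc (-D) 0, Vec k) //
    ∃ g : ℝ → Vec k, ContDiffOn ℝ 1 g (Icc (-D) 0) ∧ ∀ θ : Icc (-D) 0, g θ = U θ}

/-- Lebesgue measure on `[-D, 0]`. -/
def lebesgue (D : ℝ) : Measure (Icc (-D) 0) := Measure.comap Subtype.val volume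

/-! ### The dynamics `X' = f (X, w)` -/

/-- Lipschitz dynamics: on all compact sets of states and of inputs, `f` is Lipschitz with a
constant that may depend on these sets. -/
def LipschitzDynamics {n m : ℕ} (f : Vec n → Vec m → Vec n) : Prop :=
  ∀ (A : Set (Vec n)) (B : Set (Vec m)), IsCompact A → IsCompact B →
    ∃ C : ℝ, 0 < C ∧ ∀ x₁ ∈ A, ∀ x₂ ∈ A, ∀ u₁ ∈ B, ∀ u₂ ∈ B,
      ‖f x₁ u₁ - f x₂ u₂‖ ≤ C * (‖x₁ - x₂‖ + ‖u₁ - u₂‖)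

/-- Forward completeness: for every initial state and every continuous input there is a solution
of `X' = f (X, w)` on all of `[0, ∞)`. -/
def ForwardComplete {n m : ℕ} (f : Vec n → Vec m → Vec n) : Prop :=
  ∀ (x₀ : Vec n) (w : ℝ → Vec m), Continuous w →
    ∃ x : ℝ → Vec n, x 0 = x₀ ∧
      ∀ t : ℝ, 0 ≤ t → HasDerivWithinAt x (f (x t) (w t)) (Ici 0) t

/-! ### The predictor operator -/

/-- `P` solves `P(s) - ∫_{-D}^s f(P(θ), U(θ)) dθ - X = 0` for all `s ∈ [-D, 0]`.  The integration
variable ranges over `[-D, 0]` with Lebesgue measure, restricted to `θ ≤ s`. -/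
def IsPredictor {n m : ℕ} (f : Vec n → Vec m → Vec n) {D : ℝ} (X : Vec n) (U : C1 D m)
    (P : C1 D n) : Prop :=
  ∀ s : Icc (-D) 0, P.1 s - (∫ θ in Iic s, f (P.1 θ) (U.1 θ) ∂lebesgue D) - X = 0

instance {D : ℝ} {k : ℕ} : Nonempty (C1 D k) :=
  ⟨⟨0, fun _ => 0, contDiffOn_const, fun _ => rfl⟩⟩

/-- The predictor operator `𝒫 : ℝⁿ × C¹([-D, 0]; ℝᵐ) → C¹([-D, 0]; ℝⁿ)`. -/
def predictor {n m : ℕ} (f : Vec n → Vec m → Vec n) {D : ℝ} (p : Vec n × C1 D m) : C1 D n :=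
  Classical.epsilon (IsPredictor f p.1 p.2)

/-! ### Neural networks and nonlocal neural operators -/

/-- A smooth activation function that is not a polynomial. -/
structure IsActivation (σ : ℝ → ℝ) : Prop where
  smooth : ContDiff ℝ ∞ σ
  nonpolynomial : ¬ ∃ p : Polynomial ℝ, ∀ x, σ x = p.eval x

/-- The parameters of a feedforward neural network `ℝᵃ → ℝᵇ` of arbitrary depth and widths. -/
inductive Net : ℕ → ℕ → Type
  | output {a b : ℕ} (W : Matrix (Fin b) (Fin a) ℝ) (β : Fin b → ℝ) : Net a b
  | layer {a h b : ℕ} (W : Matrix (Fin h) (Fin a) ℝ) (β : Fin h → ℝ) (rest : Net h b) : Net a b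

/-- The function computed by a network: affine layers, with the activation `σ` applied
componentwise after every layer except the last one. -/
def Net.eval (σ : ℝ → ℝ) : {a b : ℕ} → Net a b → (Fin a → ℝ) → (Fin b → ℝ)
  | _, _, .output W β, v => W.mulVec v + β
  | _, _, .layer W β rest, v => rest.eval σ (fun i => σ ((W.mulVec v + β) i))

/-- The parameters of a hidden layer with channel dimension `d`: a weight matrix, a bias, and a
matrix-valued kernel `K(x, y)` whose entries are neural networks of `(x, y)`. -/
structure HiddenLayer (d : ℕ) where
  W : Matrix (Fin d) (Fin d) ℝ
  b : Fin d → ℝ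
  kernel : Fin d → Fin d → Net 2 1

/-- The kernel matrix `K(x, y)`. -/
def HiddenLayer.K (σ : ℝ → ℝ) {d : ℕ} (l : HiddenLayer d) (x y : ℝ) : Matrix (Fin d) (Fin d) ℝ :=
  Matrix.of fun i j => (l.kernel i j).eval σ ![x, y] 0

/-- The action of a hidden layer on functions on `[-D, 0]`:
`(ℒ v)(x) = σ (W v(x) + b + ∫_{[-D, 0]} K(x, y) v(y) dy)`, with `σ` applied componentwise. -/
def HiddenLayer.eval (σ : ℝ → ℝ) {D : ℝ} {d : ℕ} (l : HiddenLayer d)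
    (v : Icc (-D) 0 → Fin d → ℝ) : Icc (-D) 0 → Fin d → ℝ :=
  fun x i => σ ((l.W.mulVec (v x) + l.b + ∫ y, (l.K σ x y).mulVec (v y) ∂lebesgue D) i)

/-- The parameters of a nonlocal neural operator `𝒬 ∘ ℒ_L ∘ ⋯ ∘ ℒ_1 ∘ ℛ` which maps functions
`[-D, 0] → ℝᶜ` to functions `[-D, 0] → ℝᵏ`: a channel dimension, the network of the lifting
layer, the hidden layers (at least one, in the order of application), and the network of the
projection layer. -/
structure NeuralOperator (c k : ℕ) where
  channels : ℕ
  channels_pos : 0 < channels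
  lift : Net (c + 1) channels
  layers : List (HiddenLayer channels)
  layers_ne_nil : layers ≠ []
  proj : Net (channels + 1) k

/-- The map computed by a nonlocal neural operator.  The lifting layer is `v(x) = R(c(x), x)`, and
the projection layer is `y ↦ Q(v(y), y)`. -/
def NeuralOperator.eval (σ : ℝ → ℝ) {D : ℝ} {c k : ℕ} (N : NeuralOperator c k)
    (u : Icc (-D) 0 → Fin c → ℝ) : Icc (-D) 0 → Fin k → ℝ :=
  let v₀ : Icc (-D) 0 → Fin N.channels → ℝ :=
    fun x => N.lift.eval σ (Fin.append (u x) ![(x : ℝ)])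
  let v : Icc (-D) 0 → Fin N.channels → ℝ := N.layers.foldl (fun w l => l.eval σ w) v₀
  fun y => N.proj.eval σ (Fin.append (v y) ![(y : ℝ)])

/-- A pair `(X, U)` as one input function `x ↦ (X, U(x))` on `[-D, 0]`. -/
def inputFunction {n m : ℕ} {D : ℝ} (p : Vec n × C1 D m) : Icc (-D) 0 → Fin (n + m) → ℝ :=
  fun x => Fin.append (fun i => p.1 i) (fun j => p.2.1 x j)

/-- The map `Phat : K → C¹([-D, 0]; ℝⁿ)` is given by a nonlocal neural operator with
activation `σ`. -/
def IsNeuralOperator (σ : ℝ → ℝ) {n m : ℕ} {D : ℝ} {K : Set (Vec n × C1 D m)}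
    (Phat : K → C1 D n) : Prop :=
  ∃ N : NeuralOperator (n + m) n, ∀ (p : K) (θ : Icc (-D) 0) (i : Fin n),
    (Phat p).1 θ i = N.eval σ (inputFunction p.1) θ i

end DelayPredictor

end

open DelayPredictor

/-!
The predictor equation is the integral form of `P' = f (P, U)`, `P (-D) = X`. Forward completeness
provides a solution, and `IsPredictor.stability` shows that the solution is unique and depends
continuously on `(X, U)` in the uniform norm. Hence `(p, θ) ↦ 𝒫(p)(θ)` is a continuous function on
the compact space `K × [-D, 0]`, and only a density statement for neural operators is left.

The density statement is universal approximation in an abstract form (`closure_ridgeSpan_eq_top`):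
if a linear space `V` of continuous functions on a compact space `Z` separates points, then the
functions `σ ∘ (a + b)`, with `a ∈ V` and `b` a constant, span a dense subspace of `C(Z, ℝ)`. The
closure of the span contains every `a ^ k`, because differentiating `k` times in the weights gives
`a ^ k * σ⁽ᵏ⁾ (b)`, where `b` can be chosen with `σ⁽ᵏ⁾ (b) ≠ 0` since `σ` is not a polynomial. So it
contains `exp a`, and the exponentials of the elements of `V` span an algebra that separates points,
to which the Stone–Weierstrass theorem applies.

This is used twice. On `Z = [-D, 0]` it shows that the neurons `σ (w y + b)` are total, so the
features `p ↦ σ (β + ∫ s σ (w y + b) c(y) dy)`, with `c` a read-out of the input function, separate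
the points of `K` (`exists_feature_ne`). On `Z = K × [-D, 0]`, with `V` spanned by the features and
the position `θ`, it approximates every coordinate of the predictor by a finite sum of neurons whose
preactivations lie in `V`. Such a sum is a neural operator with one nonlocal layer
(`exists_neuralOperator_eval_eq`): the lifting computes the read-outs, the hidden layer has weight
matrix `0` and a diagonal kernel and computes the features, and the projection is a network with one
hidden layer, fed by the features and the position.
-/

namespace DelayPredictor

/-! ### Density of ridge functions with a smooth nonpolynomial activation -/

section Density

lemma exists_polynomial_of_deriv_eq {τ : ℝ → ℝ} (hτ : Differentiable ℝ τ) {p : Polynomial ℝ}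
    (hp : ∀ x, deriv τ x = p.eval x) : ∃ q : Polynomial ℝ, ∀ x, τ x = q.eval x := by
  let q : Polynomial ℝ := p.sum fun k c => Polynomial.monomial (k + 1) (c / (k + 1))
  have hq : q.derivative = p := by
    simp only [q, Polynomial.sum_def, Polynomial.derivative_sum, Polynomial.derivative_monomial]
    conv_rhs => rw [p.as_sum_support]
    refine Finset.sum_congr rfl fun k _ => ?_
    have : (k : ℝ) + 1 ≠ 0 := by positivity
    simp [this]
  have hconst : ∀ x, τ x - q.eval x = τ 0 - q.eval 0 := fun x =>
    is_const_of_deriv_eq_zero (f := fun x => τ x - q.eval x) (hτ.sub q.differentiable)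
      (fun y => by rw [deriv_fun_sub (hτ y) q.differentiableAt, hp, Polynomial.deriv, hq, sub_self])
      x 0
  exact ⟨q + Polynomial.C (τ 0 - q.eval 0), fun x => by
    rw [Polynomial.eval_add, Polynomial.eval_C, ← hconst x]; ring⟩

lemma exists_polynomial_of_iteratedDeriv_eq_zero (k : ℕ) :
    ∀ τ : ℝ → ℝ, ContDiff ℝ ∞ τ → (∀ x, iteratedDeriv k τ x = 0) →
      ∃ q : Polynomial ℝ, ∀ x, τ x = q.eval x := by
  induction k with
  | zero => exact fun τ _ h => ⟨0, fun x => by simpa using h x⟩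
  | succ k ih =>
    intro τ hτ h
    have hd : ContDiff ℝ ∞ (deriv τ) := (contDiff_infty_iff_deriv.mp hτ).2
    obtain ⟨p, hp⟩ := ih (deriv τ) hd fun x => by rw [← iteratedDeriv_succ']; exact h x
    exact exists_polynomial_of_deriv_eq (hτ.differentiable (by simp)) hp

lemma IsActivation.exists_iteratedDeriv_ne_zero {σ : ℝ → ℝ} (hσ : IsActivation σ) (k : ℕ) :
    ∃ b, iteratedDeriv k σ b ≠ 0 := by
  by_contra! h
  exact hσ.nonpolynomial (exists_polynomial_of_iteratedDeriv_eq_zero k σ hσ.smooth h)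

lemma IsActivation.exists_ne {σ : ℝ → ℝ} (hσ : IsActivation σ) : ∃ x y, σ x ≠ σ y := by
  by_contra! h
  exact hσ.nonpolynomial ⟨Polynomial.C (σ 0), fun x => by simpa using h x 0⟩

lemma IsActivation.continuous {σ : ℝ → ℝ} (hσ : IsActivation σ) : Continuous σ :=
  hσ.smooth.continuous

variable {Z : Type*} [TopologicalSpace Z] [CompactSpace Z]

/-- Differentiation of a composition along a line, in the Banach space `C(Z, ℝ)`. It holds because
the composition is the primitive of the continuous curve `s ↦ a * τ' ∘ (c + s • a)`. -/
lemma hasDerivAt_comp_line (τ τ' : C(ℝ, ℝ)) (hτ : ∀ x, HasDerivAt τ (τ' x) x) (a c : C(Z, ℝ)) :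
    HasDerivAt (fun h : ℝ => τ.comp (c + h • a)) (a * τ'.comp c) 0 := by
  let F : ℝ → C(Z, ℝ) := fun s => a * τ'.comp (c + s • a)
  have hF : Continuous F := by
    refine continuous_const.mul ?_
    exact (ContinuousMap.continuous_postcomp τ').comp
      (continuous_const.add (continuous_id.smul continuous_const))
  have key : (fun h : ℝ => τ.comp (c + h • a)) = fun h => τ.comp c + ∫ s in (0 : ℝ)..h, F s := by
    funext h
    ext z
    have h1 : (∫ s in (0 : ℝ)..h, F s) z = ∫ s in (0 : ℝ)..h, (F s) z :=
      ((ContinuousMap.evalCLM ℝ z).intervalIntegral_comp_comm (hF.intervalIntegrable 0 h)).symm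
    have h2 : ∫ s in (0 : ℝ)..h, (F s) z = τ (c z + h * a z) - τ (c z + 0 * a z) := by
      refine intervalIntegral.integral_eq_sub_of_hasDerivAt
        (f := fun s => τ (c z + s * a z)) (fun s _ => ?_) ?_
      · have := (hτ (c z + s * a z)).comp s (((hasDerivAt_id s).mul_const (a z)).const_add (c z))
        simpa [F, mul_comm, Function.comp_def] using this
      · exact ((ContinuousMap.evalCLM ℝ z).continuous.comp hF).intervalIntegrable _ _
    rw [ContinuousMap.add_apply, h1, h2]
    simp
  rw [key]
  -- The derivative of the primitive at `0` is the integrand there, `a * τ' ∘ c`.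
  have := (intervalIntegral.integral_hasDerivAt_right (hF.intervalIntegrable 0 0)
    hF.stronglyMeasurable.stronglyMeasurableAtFilter hF.continuousAt).const_add (τ.comp c)
  simpa [F] using this

/-- The linear span of the functions `σ ∘ (a + b)` with `a ∈ V` and `b` a constant: the functions
computed by networks with one hidden layer whose preactivations are taken from `V`. -/
def ridgeSpan (σ : C(ℝ, ℝ)) (V : Submodule ℝ C(Z, ℝ)) : Submodule ℝ C(Z, ℝ) :=
  Submodule.span ℝ (range fun q : V × ℝ => σ.comp (q.1 + ContinuousMap.const Z q.2))

/-- Differentiating `k` times in the weights produces the factor `a ^ k`. -/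
lemma pow_mul_iteratedDeriv_mem (σ : C(ℝ, ℝ)) (hσ : ContDiff ℝ ∞ σ) (V : Submodule ℝ C(Z, ℝ))
    {a : C(Z, ℝ)} (ha : a ∈ V) (b : ℝ) (k : ℕ) :
    ∀ c ∈ V,
      a ^ k * (⟨iteratedDeriv k σ, hσ.continuous_iteratedDeriv k (mod_cast le_top)⟩ :
        C(ℝ, ℝ)).comp (c + ContinuousMap.const Z b) ∈ (ridgeSpan σ V).topologicalClosure := by
  induction k with
  | zero =>
    intro c hc
    refine Submodule.le_topologicalClosure _ (Submodule.subset_span ⟨(⟨c, hc⟩, b), ?_⟩)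
    ext z
    simp
  | succ k ih =>
    intro c hc
    have hd := hasDerivAt_comp_line
      ⟨iteratedDeriv k σ, hσ.continuous_iteratedDeriv k (mod_cast le_top)⟩
      ⟨iteratedDeriv (k + 1) σ, hσ.continuous_iteratedDeriv (k + 1) (mod_cast le_top)⟩
      (fun x => by
        have := (hσ.differentiable_iteratedDeriv k (mod_cast ENat.natCast_lt_top k) x).hasDerivAt
        simpa [iteratedDeriv_succ] using this) a (c + ContinuousMap.const Z b)
    have hd' := (hd.const_mul (a ^ k)).tendsto_slope_zero
    rw [← mul_assoc, ← pow_succ] at hd'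
    refine (Submodule.isClosed_topologicalClosure _).mem_of_tendsto hd'
      (Filter.Eventually.of_forall fun t => Submodule.smul_mem _ _ (Submodule.sub_mem _ ?_ ?_))
    · have := ih (c + t • a) (V.add_mem hc (V.smul_mem t ha))
      simpa [add_right_comm] using this
    · simpa using ih c hc

lemma pow_mem_closure_ridgeSpan (σ : C(ℝ, ℝ)) (hσ : IsActivation σ) (V : Submodule ℝ C(Z, ℝ))
    {a : C(Z, ℝ)} (ha : a ∈ V) (k : ℕ) : a ^ k ∈ (ridgeSpan σ V).topologicalClosure := by
  obtain ⟨b, hb⟩ := hσ.exists_iteratedDeriv_ne_zero k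
  have h := Submodule.smul_mem _ (iteratedDeriv k σ b)⁻¹
    (pow_mul_iteratedDeriv_mem σ hσ.smooth V ha b k 0 V.zero_mem)
  convert h using 1
  ext z
  simp only [ContinuousMap.smul_apply, ContinuousMap.mul_apply, ContinuousMap.comp_apply,
    ContinuousMap.const_apply, zero_add,
    ContinuousMap.coe_mk, smul_eq_mul]
  field_simp

lemma exp_mem_closure_ridgeSpan (σ : C(ℝ, ℝ)) (hσ : IsActivation σ) (V : Submodule ℝ C(Z, ℝ))
    {a : C(Z, ℝ)} (ha : a ∈ V) : NormedSpace.exp a ∈ (ridgeSpan σ V).topologicalClosure := by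
  refine (Submodule.isClosed_topologicalClosure _).mem_of_tendsto
    (NormedSpace.exp_series_hasSum_exp' (𝕂 := ℝ) a) (Filter.Eventually.of_forall fun t => ?_)
  exact Submodule.sum_mem _ fun k _ =>
    Submodule.smul_mem _ _ (pow_mem_closure_ridgeSpan σ hσ V ha k)

/-- The exponentials of the elements of a linear space of functions: a multiplicative monoid, so
that their linear span is an algebra. -/
def expSubmonoid (V : Submodule ℝ C(Z, ℝ)) : Submonoid C(Z, ℝ) where
  carrier := {g | ∃ a ∈ V, g = NormedSpace.exp a}
  one_mem' := ⟨0, V.zero_mem, by simp⟩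
  mul_mem' := by
    rintro _ _ ⟨a, ha, rfl⟩ ⟨b, hb, rfl⟩
    exact ⟨a + b, V.add_mem ha hb, NormedSpace.exp_add.symm⟩

lemma exp_apply (a : C(Z, ℝ)) (z : Z) : (NormedSpace.exp a) z = Real.exp (a z) := by
  rw [Real.exp_eq_exp_ℝ]
  exact NormedSpace.map_exp (ContinuousMap.evalAlgHom ℝ ℝ z) (continuous_eval_const z) a

/-- Universal approximation: if the preactivations separate the points of the compact space `Z`,
then networks with one hidden layer are dense in `C(Z, ℝ)`. -/
theorem closure_ridgeSpan_eq_top (σ : C(ℝ, ℝ)) (hσ : IsActivation σ) (V : Submodule ℝ C(Z, ℝ))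
    (hV : ∀ x y : Z, x ≠ y → ∃ a ∈ V, a x ≠ a y) : (ridgeSpan σ V).topologicalClosure = ⊤ := by
  let A : Subalgebra ℝ C(Z, ℝ) := Algebra.adjoin ℝ (expSubmonoid V : Set C(Z, ℝ))
  have hA : Subalgebra.toSubmodule A ≤ (ridgeSpan σ V).topologicalClosure := by
    rw [Algebra.adjoin_eq_span, Submonoid.closure_eq, Submodule.span_le]
    rintro _ ⟨a, ha, rfl⟩
    exact exp_mem_closure_ridgeSpan σ hσ V ha
  have hsep : A.SeparatesPoints := by
    intro x y hxy
    obtain ⟨a, ha, hne⟩ := hV x y hxy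
    refine ⟨_, ⟨NormedSpace.exp a, Algebra.subset_adjoin ⟨a, ha, rfl⟩, rfl⟩, ?_⟩
    simpa [exp_apply] using hne
  rw [eq_top_iff]
  intro g _
  have hg := ContinuousMap.continuousMap_mem_subalgebra_closure_of_separatesPoints A hsep g
  exact closure_minimal (s := (A : Set C(Z, ℝ))) hA
    (Submodule.isClosed_topologicalClosure _) hg

lemma exists_mem_ridgeSpan_near (σ : C(ℝ, ℝ)) (hσ : IsActivation σ) (V : Submodule ℝ C(Z, ℝ))
    (hV : ∀ x y : Z, x ≠ y → ∃ a ∈ V, a x ≠ a y) (g : C(Z, ℝ)) {ε : ℝ} (hε : 0 < ε) :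
    ∃ h ∈ ridgeSpan σ V, ∀ z, |g z - h z| < ε := by
  have hg : g ∈ closure (ridgeSpan σ V : Set C(Z, ℝ)) := by
    have : g ∈ (ridgeSpan σ V).topologicalClosure := by
      rw [closure_ridgeSpan_eq_top σ hσ V hV]; trivial
    exact this
  obtain ⟨h, hh, hd⟩ := Metric.mem_closure_iff.mp hg ε hε
  refine ⟨h, hh, fun z => ?_⟩
  rw [← Real.dist_eq]
  exact (ContinuousMap.dist_apply_le_dist z).trans_lt hd

end Density

end DelayPredictor

namespace DelayPredictor

/-! ### Lebesgue measure on the delay interval -/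

section Lebesgue

variable {D : ℝ}

instance : IsFiniteMeasure (lebesgue D) := by
  constructor
  rw [lebesgue, (MeasurableEmbedding.subtype_coe measurableSet_Icc).comap_apply]
  exact (measure_mono (Subtype.coe_image_subset _ _)).trans_lt measure_Icc_lt_top

variable {E : Type*} [NormedAddCommGroup E] [NormedSpace ℝ E]

lemma integral_lebesgue (hD : 0 ≤ D) (g : Icc (-D) 0 → E) :
    ∫ y, g y ∂lebesgue D = ∫ t in (-D)..0, IccExtend (neg_nonpos.mpr hD) g t := by
  rw [intervalIntegral.integral_of_le (neg_nonpos.mpr hD), ← integral_Icc_eq_integral_Ioc,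
    ← integral_subtype_comap measurableSet_Icc]
  simp [lebesgue]

lemma setIntegral_Iic_lebesgue (hD : 0 ≤ D) (g : Icc (-D) 0 → E) (s : Icc (-D) 0) :
    ∫ y in Iic s, g y ∂lebesgue D = ∫ t in (-D)..s, IccExtend (neg_nonpos.mpr hD) g t := by
  rw [intervalIntegral.integral_of_le s.2.1, ← integral_Icc_eq_integral_Ioc,
    ← integral_indicator measurableSet_Iic]
  have h1 : (Iic s).indicator g = fun y : Icc (-D) 0 =>
      (Iic (s : ℝ)).indicator (IccExtend (neg_nonpos.mpr hD) g) y := by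
    funext y
    by_cases h : y ≤ s
    · rw [indicator_of_mem (mem_Iic.mpr h), indicator_of_mem (show (y : ℝ) ∈ Iic (s : ℝ) from h),
        IccExtend_val]
    · rw [indicator_of_notMem (mt mem_Iic.mp h), indicator_of_notMem]
      exact h
  have h2 : Icc (-D) 0 ∩ Iic (s : ℝ) = Icc (-D) s := by
    ext t
    exact ⟨fun h => ⟨h.1.1, h.2⟩, fun h => ⟨⟨h.1, h.2.trans s.2.2⟩, h.2⟩⟩
  rw [h1, lebesgue, integral_subtype_comap measurableSet_Icc,
    setIntegral_indicator measurableSet_Iic, h2]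

end Lebesgue

/-! ### The predictor as the solution of an initial value problem -/

section Predictor

variable {n m : ℕ} {D : ℝ} {f : Vec n → Vec m → Vec n}

lemma LipschitzDynamics.continuous (hf : LipschitzDynamics f) :
    Continuous fun p : Vec n × Vec m => f p.1 p.2 := by
  rw [continuous_iff_continuousAt]
  rintro ⟨x, u⟩
  obtain ⟨C, hC, h⟩ := hf (Metric.closedBall x 1) (Metric.closedBall u 1)
    (isCompact_closedBall x 1) (isCompact_closedBall u 1)
  have h0 : Filter.Tendsto (fun p : Vec n × Vec m => C * (‖p.1 - x‖ + ‖p.2 - u‖))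
      (nhds (x, u)) (nhds 0) := by
    have : Continuous fun p : Vec n × Vec m => C * (‖p.1 - x‖ + ‖p.2 - u‖) := by fun_prop
    simpa using this.tendsto (x, u)
  refine tendsto_iff_norm_sub_tendsto_zero.mpr
    (squeeze_zero' (Filter.Eventually.of_forall fun _ => norm_nonneg _) ?_ h0)
  filter_upwards [Metric.closedBall_mem_nhds (x, u) one_pos] with p hp
  rw [← closedBall_prod_same] at hp
  exact h p.1 hp.1 x (Metric.mem_closedBall_self zero_le_one) p.2 hp.2 u
    (Metric.mem_closedBall_self zero_le_one)

/-- The integral equation, rewritten with an interval integral over the real line. -/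
lemma isPredictor_iff (hD : 0 ≤ D) (X : Vec n) (U : C1 D m) (P : C1 D n) :
    IsPredictor f X U P ↔ ∀ s : Icc (-D) 0, P.1 s = X + ∫ t in (-D)..s,
      f (IccExtend (neg_nonpos.mpr hD) P.1 t) (IccExtend (neg_nonpos.mpr hD) U.1 t) := by
  refine forall_congr' fun s => ?_
  rw [setIntegral_Iic_lebesgue hD, sub_sub, sub_eq_zero, add_comm]
  rfl

/-- A predictor extends to a solution on the closed interval of the differential equation. -/
lemma IsPredictor.exists_hasDerivAt (hf : LipschitzDynamics f) (hD : 0 ≤ D) {X : Vec n}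
    {U : C1 D m} {P : C1 D n} (hP : IsPredictor f X U P) :
    ∃ y : ℝ → Vec n, (∀ s : Icc (-D) 0, y s = P.1 s) ∧ y (-D) = X ∧ Continuous y ∧
      ∀ t ∈ Icc (-D) 0, HasDerivAt y (f (y t) (IccExtend (neg_nonpos.mpr hD) U.1 t)) t := by
  rw [isPredictor_iff hD] at hP
  let F : ℝ → Vec n := fun t =>
    f (IccExtend (neg_nonpos.mpr hD) P.1 t) (IccExtend (neg_nonpos.mpr hD) U.1 t)
  have hF : Continuous F :=
    hf.continuous.comp (P.1.continuous.Icc_extend'.prodMk U.1.continuous.Icc_extend')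
  have hder : ∀ t, HasDerivAt (fun s => X + ∫ t in (-D)..s, F t) (F t) t := fun t =>
    (intervalIntegral.integral_hasDerivAt_right (hF.intervalIntegrable _ _)
      hF.stronglyMeasurable.stronglyMeasurableAtFilter hF.continuousAt).const_add X
  refine ⟨_, fun s => (hP s).symm, by simp,
    continuous_iff_continuousAt.mpr fun t => (hder t).continuousAt, fun t ht => ?_⟩
  convert hder t using 1
  have := hP ⟨t, ht⟩
  simp only [F, ← this, IccExtend_of_mem _ _ ht]

/-- Quantitative continuous dependence of a predictor on the data near a reference predictor. The
local Lipschitz constant suffices: before the first time at which the two predictors are `ε` apart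
both stay in a fixed ball, and Grönwall's inequality there excludes that such a time exists. -/
lemma IsPredictor.stability (hf : LipschitzDynamics f) (hD : 0 ≤ D) {X₀ : Vec n} {U₀ : C1 D m}
    {P₀ : C1 D n} (hP₀ : IsPredictor f X₀ U₀ P₀) :
    ∃ M : ℝ, 0 < M ∧ ∀ (X : Vec n) (U : C1 D m) (P : C1 D n) (η ε : ℝ), IsPredictor f X U P →
      dist X X₀ ≤ η → dist U U₀ ≤ η → η ≤ 1 → ε ≤ 1 → M * η < ε →
      ∀ s, dist (P.1 s) (P₀.1 s) < ε := by
  have hD' : -D ≤ 0 := neg_nonpos.mpr hD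
  obtain ⟨C, hC, hLip⟩ := hf (Metric.closedBall 0 (‖P₀.1‖ + 1)) (Metric.closedBall 0 (‖U₀.1‖ + 1))
    (isCompact_closedBall _ _) (isCompact_closedBall _ _)
  refine ⟨2 * Real.exp (C * D), by positivity, ?_⟩
  intro X U P η ε hP hX hU hη hε hlt
  have hη0 : 0 ≤ η := dist_nonneg.trans hX
  obtain ⟨y₀, hy₀, hy₀D, hy₀c, hy₀'⟩ := hP₀.exists_hasDerivAt hf hD
  obtain ⟨y, hy, hyD, hyc, hy'⟩ := hP.exists_hasDerivAt hf hD
  have hmem₀ : ∀ t ∈ Icc (-D) 0, ‖y₀ t‖ ≤ ‖P₀.1‖ := fun t ht => by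
    rw [hy₀ ⟨t, ht⟩]; exact P₀.1.norm_coe_le_norm _
  have hUU : ∀ s, dist (U.1 s) (U₀.1 s) ≤ η := fun s =>
    (ContinuousMap.dist_apply_le_dist s).trans hU
  have hUm₀ : ∀ t, IccExtend hD' U₀.1 t ∈ Metric.closedBall (0 : Vec m) (‖U₀.1‖ + 1) := fun t => by
    rw [mem_closedBall_zero_iff]
    exact (U₀.1.norm_coe_le_norm _).trans (by linarith)
  have hUm : ∀ t, IccExtend hD' U.1 t ∈ Metric.closedBall (0 : Vec m) (‖U₀.1‖ + 1) := fun t => by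
    rw [mem_closedBall_zero_iff]
    have h1 := hUU (projIcc (-D) 0 hD' t)
    have h2 := U₀.1.norm_coe_le_norm (projIcc (-D) 0 hD' t)
    rw [dist_eq_norm] at h1
    have h3 := norm_le_norm_add_norm_sub' (U.1 (projIcc (-D) 0 hD' t))
      (U₀.1 (projIcc (-D) 0 hD' t))
    change ‖U.1 (projIcc (-D) 0 hD' t)‖ ≤ _
    linarith
  -- Otherwise the two solutions are `ε` apart at a first time `t₁`.
  by_contra! hcon
  obtain ⟨s, hs⟩ := hcon
  have hcpt : IsCompact (Icc (-D) 0 ∩ {t | ε ≤ dist (y t) (y₀ t)}) :=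
    isCompact_Icc.inter_right (isClosed_le continuous_const (hyc.dist hy₀c))
  obtain ⟨t₁, ⟨ht₁, ht₁ε⟩, hleast⟩ :=
    hcpt.exists_isLeast ⟨s, s.2, by simpa only [mem_ofPred_eq, hy, hy₀] using hs⟩
  have hbefore : ∀ t ∈ Ico (-D) t₁, dist (y t) (y₀ t) < ε := fun t ht => by
    by_contra! h
    exact (hleast ⟨⟨ht.1, ht.2.le.trans ht₁.2⟩, h⟩).not_gt ht.2
  have hIcc : ∀ t ∈ Ico (-D) t₁, t ∈ Icc (-D) 0 := fun t ht => ⟨ht.1, ht.2.le.trans ht₁.2⟩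
  have hym₀ : ∀ t ∈ Ico (-D) t₁, y₀ t ∈ Metric.closedBall (0 : Vec n) (‖P₀.1‖ + 1) := fun t ht => by
    rw [mem_closedBall_zero_iff]
    linarith [hmem₀ t (hIcc t ht)]
  have hym : ∀ t ∈ Ico (-D) t₁, y t ∈ Metric.closedBall (0 : Vec n) (‖P₀.1‖ + 1) := fun t ht => by
    rw [mem_closedBall_zero_iff]
    have h1 := hbefore t ht
    rw [dist_eq_norm] at h1
    linarith [hmem₀ t (hIcc t ht), norm_le_norm_add_norm_sub' (y t) (y₀ t)]
  have hgron := dist_le_of_approx_trajectories_ODE_of_mem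
    (v := fun t x => f x (IccExtend hD' U.1 t)) (K := ⟨C, hC.le⟩)
    (s := fun _ => Metric.closedBall 0 (‖P₀.1‖ + 1)) (a := -D) (b := t₁)
    (f := y) (g := y₀) (f' := fun t => f (y t) (IccExtend hD' U.1 t))
    (g' := fun t => f (y₀ t) (IccExtend hD' U₀.1 t)) (εf := 0) (εg := C * η) (δ := η)
    (fun t _ => LipschitzOnWith.of_dist_le_mul fun x hx x' hx' => by
      have h := hLip x hx x' hx' _ (hUm t) _ (hUm t)
      rw [sub_self, norm_zero, add_zero, ← dist_eq_norm, ← dist_eq_norm] at h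
      exact h)
    hyc.continuousOn (fun t ht => (hy' t (hIcc t ht)).hasDerivWithinAt)
    (fun t _ => by simp) hym
    hy₀c.continuousOn (fun t ht => (hy₀' t (hIcc t ht)).hasDerivWithinAt)
    (fun t ht => by
      rw [dist_eq_norm]
      refine (hLip _ (hym₀ t ht) _ (hym₀ t ht) _ (hUm₀ t) _ (hUm t)).trans ?_
      rw [sub_self, norm_zero, zero_add, ← dist_eq_norm, dist_comm]
      exact mul_le_mul_of_nonneg_left (hUU _) hC.le)
    hym₀ (by rw [hyD, hy₀D]; exact hX) t₁ ⟨ht₁.1, le_rfl⟩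
  have hexp : Real.exp (C * (t₁ - -D)) ≤ Real.exp (C * D) :=
    Real.exp_le_exp.mpr (mul_le_mul_of_nonneg_left (by linarith [ht₁.2]) hC.le)
  have hbound : gronwallBound η C (0 + C * η) (t₁ - -D) ≤ 2 * Real.exp (C * D) * η := by
    rw [gronwallBound_of_K_ne_0 hC.ne', zero_add, mul_div_cancel_left₀ _ hC.ne']
    nlinarith
  exact absurd (ht₁ε.trans (hgron.trans hbound)) (not_le.mpr hlt)

lemma IsPredictor.unique (hf : LipschitzDynamics f) (hD : 0 ≤ D) {X : Vec n} {U : C1 D m}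
    {P Q : C1 D n} (hP : IsPredictor f X U P) (hQ : IsPredictor f X U Q) : P = Q := by
  obtain ⟨M, -, h⟩ := hQ.stability hf hD
  refine Subtype.ext (ContinuousMap.ext fun s => dist_le_zero.mp ?_)
  refine le_of_forall_gt_imp_ge_of_dense fun ε hε => ?_
  have := h X U P 0 (min ε 1) hP (by simp) (by simp) zero_le_one (min_le_right _ _)
    (by simpa using hε) s
  exact this.le.trans (min_le_left _ _)

/-- Shifting the forward solution with input `t ↦ U (t - D)` in time by `D` gives a predictor. -/
lemma exists_isPredictor (hf : LipschitzDynamics f) (hfc : ForwardComplete f) (hD : 0 ≤ D)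
    (X : Vec n) (U : C1 D m) : ∃ P : C1 D n, IsPredictor f X U P := by
  have hD' : -D ≤ 0 := neg_nonpos.mpr hD
  obtain ⟨x, hx0, hx⟩ := hfc X (fun t => IccExtend hD' U.1 (t - D))
    (U.1.continuous.Icc_extend'.comp (continuous_id.sub continuous_const))
  have hxc : ContinuousOn x (Ici 0) := fun t ht => (hx t ht).continuousWithinAt
  have hmaps : MapsTo (fun s => s + D) (Icc (-D) 0) (Ici 0) := fun s hs => by
    simp only [mem_Ici]; linarith [hs.1]
  have hpc : ContinuousOn (fun s => x (s + D)) (Icc (-D) 0) :=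
    hxc.comp (by fun_prop) hmaps
  let p : C(Icc (-D) 0, Vec n) := ⟨fun s => x (s + D), hpc.domRestrict⟩
  have hpx : ∀ s : Icc (-D) 0, p s = x (s + D) := fun _ => rfl
  let F : ℝ → Vec n := fun t => f (IccExtend hD' p t) (IccExtend hD' U.1 t)
  have hF : Continuous F :=
    hf.continuous.comp (p.continuous.Icc_extend'.prodMk U.1.continuous.Icc_extend')
  have hder : ∀ t, HasDerivAt (fun s => X + ∫ t in (-D)..s, F t) (F t) t := fun t =>
    (intervalIntegral.integral_hasDerivAt_right (hF.intervalIntegrable _ _)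
      hF.stronglyMeasurable.stronglyMeasurableAtFilter hF.continuousAt).const_add X
  have hp : ∀ s : Icc (-D) 0, p s = X + ∫ t in (-D)..s, F t := fun s => by
    have hsub : Icc (-D) (s : ℝ) ⊆ Icc (-D) 0 := Icc_subset_Icc_right s.2.2
    have := intervalIntegral.integral_eq_sub_of_hasDeriv_right_of_le (f := fun t => x (t + D))
      (f' := F) s.2.1 (hpc.mono hsub)
      (fun t ht => by
        have ht' : t ∈ Icc (-D) 0 := hsub (Ioo_subset_Icc_self ht)
        have h1 : HasDerivWithinAt x (F t) (Ici 0) (t + D) := by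
          have := hx (t + D) (hmaps ht')
          simpa [F, hpx, IccExtend_of_mem _ _ ht'] using this
        have h2 : HasDerivAt x (F t) (t + D) :=
          h1.hasDerivAt (Ici_mem_nhds (by linarith [ht.1]))
        exact (h2.comp_add_const t D).hasDerivWithinAt)
      (hF.intervalIntegrable _ _)
    rw [this]
    simp [hpx, hx0]
  refine ⟨⟨p, fun s => X + ∫ t in (-D)..s, F t, ?_, fun s => (hp s).symm⟩,
    (isPredictor_iff hD _ _ _).mpr hp⟩
  refine ContDiff.contDiffOn (contDiff_one_iff_deriv.mpr
    ⟨fun t => (hder t).differentiableAt, ?_⟩)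
  rwa [show deriv (fun s => X + ∫ t in (-D)..s, F t) = F from funext fun t => (hder t).deriv]

lemma predictor_spec (hf : LipschitzDynamics f) (hfc : ForwardComplete f) (hD : 0 ≤ D)
    (q : Vec n × C1 D m) : IsPredictor f q.1 q.2 (predictor f q) :=
  Classical.epsilon_spec (exists_isPredictor hf hfc hD q.1 q.2)

/-- The predictor depends continuously on the data, in the uniform norm. -/
lemma continuous_predictor (hf : LipschitzDynamics f) (hfc : ForwardComplete f) (hD : 0 ≤ D) :
    Continuous fun q : Vec n × C1 D m => (predictor f q).1 := by
  rw [Metric.continuous_iff]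
  intro q₀ ε hε
  obtain ⟨M, hM, h⟩ := (predictor_spec hf hfc hD q₀).stability hf hD
  let ε' := min (ε / 2) 1
  have hε' : 0 < ε' := lt_min (by linarith) one_pos
  refine ⟨min (ε' / (2 * M)) 1, lt_min (by positivity) one_pos, fun q hq => ?_⟩
  have hq1 : dist q q₀ ≤ 1 := hq.le.trans (min_le_right _ _)
  have hq2 : M * dist q q₀ < ε' := by
    have h1 : dist q q₀ ≤ ε' / (2 * M) := hq.le.trans (min_le_left _ _)
    have h2 : M * dist q q₀ ≤ M * (ε' / (2 * M)) := mul_le_mul_of_nonneg_left h1 hM.le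
    have h3 : M * (ε' / (2 * M)) = ε' / 2 := by field_simp
    linarith
  have hle : dist (predictor f q).1 (predictor f q₀).1 ≤ ε / 2 :=
    (ContinuousMap.dist_le (by linarith)).mpr fun s =>
      (h q.1 q.2 (predictor f q) (dist q q₀) ε' (predictor_spec hf hfc hD q) (le_max_left _ _)
        (le_max_right _ _) hq1 (min_le_right _ _) hq2 s).le.trans (min_le_left _ _)
  linarith

end Predictor

end DelayPredictor

namespace DelayPredictor

/-! ### Features: the channels of a single nonlocal layer -/

section Features

variable {n m : ℕ} {D : ℝ}

lemma continuous_inputFunction (j : Fin (n + m)) :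
    Continuous fun q : (Vec n × C1 D m) × Icc (-D) 0 => inputFunction q.1 q.2 j := by
  refine Fin.addCases (fun i => ?_) (fun i => ?_) j
  · simp only [inputFunction, Fin.append_left]
    fun_prop
  · simp only [inputFunction, Fin.append_right]
    have : Continuous fun q : (Vec n × C1 D m) × Icc (-D) 0 => q.1.2.1 q.2 :=
      continuous_eval.comp
        ((continuous_subtype_val.comp (continuous_snd.comp continuous_fst)).prodMk continuous_snd)
    exact (EuclideanSpace.proj i).continuous.comp this

/-- The parameters of a feature `u ↦ σ (β + ∫ scale * σ (w y + b) * (coef ⬝ u y) dy)`: a channel of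
a nonlocal layer whose kernel has one neuron and depends on the integration variable only. -/
structure Feature (c : ℕ) where
  coef : Fin c → ℝ
  w : ℝ
  b : ℝ
  scale : ℝ
  β : ℝ

instance {c : ℕ} : Inhabited (Feature c) := ⟨⟨0, 0, 0, 0, 0⟩⟩

/-- The weight `scale * σ (w y + b)` against which a feature integrates the input. -/
def Feature.weight (σ : ℝ → ℝ) {c : ℕ} (φ : Feature c) (y : ℝ) : ℝ := φ.scale * σ (φ.w * y + φ.b)

/-- The value of a feature at an input function. -/
noncomputable def Feature.eval (σ : ℝ → ℝ) {c : ℕ} (φ : Feature c)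
    (u : Icc (-D) 0 → Fin c → ℝ) : ℝ :=
  σ (φ.β + ∫ y, φ.weight σ y * (φ.coef ⬝ᵥ u y) ∂lebesgue D)

lemma continuous_feature_integrand {σ : ℝ → ℝ} (hσ : Continuous σ) (φ : Feature (n + m)) :
    Continuous fun q : (Vec n × C1 D m) × Icc (-D) 0 =>
      φ.weight σ q.2 * (φ.coef ⬝ᵥ inputFunction q.1 q.2) := by
  have h1 : Continuous fun q : (Vec n × C1 D m) × Icc (-D) 0 => φ.weight σ q.2 := by
    unfold Feature.weight
    fun_prop
  refine h1.mul (continuous_finsetSum _ fun j _ => ?_)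
  exact continuous_const.mul (continuous_inputFunction j)

lemma Feature.continuous_eval {σ : ℝ → ℝ} (hσ : Continuous σ) (φ : Feature (n + m))
    {K : Set (Vec n × C1 D m)} (hK : IsCompact K) :
    Continuous fun p : K => φ.eval σ (inputFunction p.1) := by
  have : CompactSpace K := isCompact_iff_compactSpace.mp hK
  have h := continuous_parametric_integral_of_continuous (μ := lebesgue D)
    (f := fun (p : K) (y : Icc (-D) 0) => φ.weight σ y * (φ.coef ⬝ᵥ inputFunction p.1 y))
    ((continuous_feature_integrand hσ φ).comp
      ((continuous_subtype_val.comp continuous_fst).prodMk continuous_snd)) isCompact_univ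
  simp only [Measure.restrict_univ] at h
  exact hσ.comp (continuous_const.add h)

/-- The neurons `σ (w y + b)` are total in `C([-D, 0])`, so that a nonzero continuous function is
not orthogonal to all of them. -/
lemma exists_integral_neuron_ne_zero {σ : ℝ → ℝ} (hσ : IsActivation σ) (hD : 0 < D)
    (h : C(Icc (-D) 0, ℝ)) (hh : h ≠ 0) :
    ∃ w b : ℝ, ∫ y, σ (w * y + b) * h y ∂lebesgue D ≠ 0 := by
  by_contra! hzero
  have hint : ∀ g : C(Icc (-D) 0, ℝ), Integrable g (lebesgue D) := fun g =>
    g.continuous.integrable_of_hasCompactSupport (HasCompactSupport.of_compactSpace _)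
  have hmul : ∀ g k : C(Icc (-D) 0, ℝ), Integrable (fun y => g y * k y) (lebesgue D) :=
    fun g k => hint (g * k)
  let ι : C(Icc (-D) 0, ℝ) := ⟨Subtype.val, continuous_subtype_val⟩
  let σc : C(ℝ, ℝ) := ⟨σ, hσ.continuous⟩
  let V : Submodule ℝ C(Icc (-D) 0, ℝ) := Submodule.span ℝ {ι}
  have horth : ∀ g ∈ ridgeSpan σc V, ∫ y, g y * h y ∂lebesgue D = 0 := by
    intro g hg
    induction hg using Submodule.span_induction with
    | mem g hg =>
      obtain ⟨⟨⟨a, ha⟩, b⟩, rfl⟩ := hg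
      obtain ⟨w, rfl⟩ := Submodule.mem_span_singleton.mp ha
      exact hzero w b
    | zero => simp
    | add g₁ g₂ _ _ h₁ h₂ =>
      simp only [ContinuousMap.add_apply, add_mul]
      rw [integral_add (hmul g₁ h) (hmul g₂ h), h₁, h₂, add_zero]
    | smul r g _ h₁ =>
      simp only [ContinuousMap.smul_apply, smul_eq_mul, mul_assoc]
      rw [integral_const_mul, h₁, mul_zero]
  have hpos : 0 < ∫ y, h y * h y ∂lebesgue D := by
    obtain ⟨y, hy⟩ : ∃ y, h y ≠ 0 := by
      by_contra! h0
      exact hh (ContinuousMap.ext h0)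
    rw [integral_lebesgue hD.le]
    refine intervalIntegral.integral_pos (neg_lt_zero.mpr hD)
      (h * h).continuous.Icc_extend'.continuousOn (fun t _ => mul_self_nonneg _) ⟨y, y.2, ?_⟩
    rw [IccExtend_val]
    exact mul_self_pos.mpr hy
  have hI : 0 ≤ ∫ y, |h y| ∂lebesgue D := integral_nonneg fun _ => abs_nonneg _
  obtain ⟨g, hg, hgh⟩ := exists_mem_ridgeSpan_near σc hσ V
    (fun x y hxy => ⟨ι, Submodule.mem_span_singleton_self ι, fun h => hxy (Subtype.ext h)⟩) h
    (ε := (∫ y, h y * h y ∂lebesgue D) / ((∫ y, |h y| ∂lebesgue D) + 1)) (by positivity)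
  set ε := (∫ y, h y * h y ∂lebesgue D) / ((∫ y, |h y| ∂lebesgue D) + 1) with hε
  have h1 : ∫ y, h y * h y ∂lebesgue D = ∫ y, (h y - g y) * h y ∂lebesgue D := by
    simp only [sub_mul]
    rw [integral_sub (hmul h h) (hmul g h), horth g hg, sub_zero]
  have h2 : ∫ y, (h y - g y) * h y ∂lebesgue D ≤ ∫ y, ε * |h y| ∂lebesgue D := by
    refine integral_mono (hint ((h - g) * h)) ((hint |h|).const_mul ε) fun y => ?_
    refine (le_abs_self _).trans ?_
    change |(h y - g y) * h y| ≤ ε * |h y|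
    rw [abs_mul]
    exact mul_le_mul_of_nonneg_right (hgh y).le (abs_nonneg _)
  rw [integral_const_mul] at h2
  have h3 : ε * ((∫ y, |h y| ∂lebesgue D) + 1) = ∫ y, h y * h y ∂lebesgue D :=
    div_mul_cancel₀ _ (by positivity)
  have h4 : 0 < ε := by positivity
  linarith

/-- Features separate the data of the predictor problem. -/
lemma exists_feature_ne {σ : ℝ → ℝ} (hσ : IsActivation σ) (hD : 0 < D) {p q : Vec n × C1 D m}
    (hpq : p ≠ q) : ∃ φ : Feature (n + m),
      φ.eval σ (inputFunction p) ≠ φ.eval σ (inputFunction q) := by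
  let u : Vec n × C1 D m → Fin (n + m) → C(Icc (-D) 0, ℝ) := fun p j =>
    ⟨fun y => inputFunction p y j,
      (continuous_inputFunction j).comp (continuous_const.prodMk continuous_id)⟩
  obtain ⟨j, hj⟩ : ∃ j, u p j ≠ u q j := by
    by_contra! h
    refine hpq (Prod.ext ?_ (Subtype.ext (ContinuousMap.ext fun y => ?_)))
    · ext i
      have := DFunLike.congr_fun (h (Fin.castAdd m i)) ⟨0, neg_nonpos.mpr hD.le, le_rfl⟩
      simpa [u, inputFunction] using this
    · ext i
      have := DFunLike.congr_fun (h (Fin.natAdd n i)) y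
      simpa [u, inputFunction] using this
  obtain ⟨w, b, hwb⟩ := exists_integral_neuron_ne_zero hσ hD (u p j - u q j) (sub_ne_zero.mpr hj)
  let I : Vec n × C1 D m → ℝ := fun p => ∫ y, σ (w * y + b) * inputFunction p y j ∂lebesgue D
  have hint : ∀ p : Vec n × C1 D m,
      Integrable (fun y : Icc (-D) 0 => σ (w * y + b) * inputFunction p y j) (lebesgue D) := by
    intro p
    have hc : Continuous fun y : Icc (-D) 0 => σ (w * y + b) * inputFunction p y j :=
      (hσ.continuous.comp (by fun_prop)).mul (u p j).continuous
    exact hc.integrable_of_hasCompactSupport (HasCompactSupport.of_compactSpace _)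
  have hI : I p ≠ I q := by
    rw [← sub_ne_zero, ← integral_sub (hint p) (hint q)]
    simpa [u, mul_sub] using hwb
  -- Rescale and shift the two integrals to points at which the activation differs.
  obtain ⟨x, y, hxy⟩ := hσ.exists_ne
  let s : ℝ := (x - y) / (I p - I q)
  have hs : s * (I p - I q) = x - y := div_mul_cancel₀ _ (sub_ne_zero.mpr hI)
  let φ : Feature (n + m) := ⟨Pi.single j 1, w, b, s, x - s * I p⟩
  have hφ : ∀ r : Vec n × C1 D m, φ.eval σ (inputFunction r) = σ (x - s * I p + s * I r) := by
    intro r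
    simp only [φ, I, Feature.eval, Feature.weight, single_dotProduct, one_mul, mul_assoc]
    rw [integral_const_mul]
  refine ⟨φ, ?_⟩
  rw [hφ, hφ, show x - s * I p + s * I p = x by ring,
    show x - s * I p + s * I q = y by linarith]
  exact hxy

/-! ### Realization by a nonlocal neural operator -/

lemma Net.eval_output (σ : ℝ → ℝ) {a b : ℕ} (W : Matrix (Fin b) (Fin a) ℝ) (β : Fin b → ℝ)
    (v : Fin a → ℝ) : (Net.output W β).eval σ v = W.mulVec v + β := by
  simp only [Net.eval]

lemma Net.eval_layer (σ : ℝ → ℝ) {a h b : ℕ} (W : Matrix (Fin h) (Fin a) ℝ) (β : Fin h → ℝ)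
    (rest : Net h b) (v : Fin a → ℝ) :
    (Net.layer W β rest).eval σ v = rest.eval σ fun i => σ ((W.mulVec v + β) i) := by
  simp only [Net.eval]

/-- The weight of a feature as a kernel network in `(x, y)` that ignores `x`. -/
def Feature.kernelNet {c : ℕ} (φ : Feature c) : Net 2 1 :=
  .layer !![0, φ.w] ![φ.b] (.output !![φ.scale] 0)

lemma Feature.eval_kernelNet (σ : ℝ → ℝ) {c : ℕ} (φ : Feature c) (x y : ℝ) :
    φ.kernelNet.eval σ ![x, y] 0 = φ.weight σ y := by
  simp [Feature.kernelNet, Feature.weight, Net.eval_layer, Net.eval_output, dotProduct,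
    mul_comm y]

/-- The hidden layer with a diagonal kernel which computes a given list of features. -/
def featureLayer {c d : ℕ} (φ : Fin d → Feature c) : HiddenLayer d where
  W := 0
  b := fun i => (φ i).β
  kernel := fun i j => if i = j then (φ i).kernelNet else .output 0 0

/-- The affine lifting which sends the value of the input to the read-outs of the features. -/
def featureLift {c d : ℕ} (φ : Fin d → Feature c) : Net (c + 1) d :=
  .output (Matrix.of fun i => Fin.append (φ i).coef ![0]) 0

lemma eval_featureLift (σ : ℝ → ℝ) {c d : ℕ} (φ : Fin d → Feature c) (u : Fin c → ℝ) (x : ℝ) :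
    (featureLift φ).eval σ (Fin.append u ![x]) = fun i => (φ i).coef ⬝ᵥ u := by
  funext i
  simp [featureLift, Net.eval_output, Matrix.mulVec, dotProduct, Fin.sum_univ_add]

lemma eval_featureLayer {σ : ℝ → ℝ} (hσ : Continuous σ) {d : ℕ} (φ : Fin d → Feature (n + m))
    (p : Vec n × C1 D m) (x : Icc (-D) 0) (i : Fin d) :
    (featureLayer φ).eval σ (fun y i => (φ i).coef ⬝ᵥ inputFunction p y) x i =
      (φ i).eval σ (inputFunction p) := by
  have hK : ∀ (y : Icc (-D) 0), ((featureLayer φ).K σ x y).mulVec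
      (fun i => (φ i).coef ⬝ᵥ inputFunction p y) =
        fun i => (φ i).weight σ y * ((φ i).coef ⬝ᵥ inputFunction p y) := by
    intro y
    funext i
    simp only [HiddenLayer.K, featureLayer, Matrix.mulVec, dotProduct, Matrix.of_apply]
    rw [Finset.sum_eq_single i]
    · rw [if_pos rfl, Feature.eval_kernelNet]
    · intro j _ hj
      rw [if_neg (Ne.symm hj)]
      simp [Net.eval_output]
    · simp
  have hint : ∀ i, Integrable (fun y : Icc (-D) 0 =>
      (φ i).weight σ y * ((φ i).coef ⬝ᵥ inputFunction p y)) (lebesgue D) := fun i =>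
    ((continuous_feature_integrand hσ (φ i)).comp
      (continuous_const.prodMk continuous_id)).integrable_of_hasCompactSupport
        (HasCompactSupport.of_compactSpace _)
  simp only [HiddenLayer.eval, hK, Feature.eval]
  rw [Pi.add_apply, Pi.add_apply, eval_integral hint]
  simp [featureLayer]

/-- The projection network: one hidden layer, fed by the channels and the position. -/
def featureProj {d h k : ℕ} (A : Fin h → Fin d → ℝ) (A₀ β : Fin h → ℝ) (C : Fin k → Fin h → ℝ) :
    Net (d + 1) k :=
  .layer (Matrix.of fun r => Fin.append (A r) ![A₀ r]) β (.output (Matrix.of C) 0)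

lemma eval_featureProj (σ : ℝ → ℝ) {d h k : ℕ} (A : Fin h → Fin d → ℝ) (A₀ β : Fin h → ℝ)
    (C : Fin k → Fin h → ℝ) (v : Fin d → ℝ) (y : ℝ) (i : Fin k) :
    (featureProj A A₀ β C).eval σ (Fin.append v ![y]) i =
      ∑ r, C i r * σ (∑ l, A r l * v l + A₀ r * y + β r) := by
  simp [featureProj, Net.eval_layer, Net.eval_output, Matrix.mulVec, dotProduct, Fin.sum_univ_add]

/-- Every map with finitely many neurons, whose preactivations are linear combinations of finitely
many features and of the position, is a nonlocal neural operator with a single hidden layer. -/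
lemma exists_neuralOperator_eval_eq {σ : ℝ → ℝ} (hσ : Continuous σ) {τ : Type*} {k : ℕ}
    (S : Finset (Feature (n + m))) (T : Finset τ) (A : τ → Feature (n + m) → ℝ) (A₀ β : τ → ℝ)
    (C : Fin k → τ → ℝ) (hS : S.Nonempty) :
    ∃ N : NeuralOperator (n + m) k, ∀ (p : Vec n × C1 D m) (θ : Icc (-D) 0) (i : Fin k),
      N.eval σ (inputFunction p) θ i = ∑ r ∈ T, C i r *
        σ (∑ φ ∈ S, A r φ * φ.eval σ (inputFunction p) + A₀ r * θ + β r) := by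
  let e : Fin S.card → Feature (n + m) := fun l => S.equivFin.symm l
  let g : Fin T.card → τ := fun r => T.equivFin.symm r
  have hsumS : ∀ F : Feature (n + m) → ℝ, ∑ l, F (e l) = ∑ φ ∈ S, F φ := fun F => by
    rw [← Finset.sum_coe_sort S F]
    exact Equiv.sum_comp S.equivFin.symm fun φ : S => F φ
  have hsumT : ∀ F : τ → ℝ, ∑ l, F (g l) = ∑ r ∈ T, F r := fun F => by
    rw [← Finset.sum_coe_sort T F]
    exact Equiv.sum_comp T.equivFin.symm fun r : T => F r
  refine ⟨⟨S.card, hS.card_pos, featureLift e, [featureLayer e], List.cons_ne_nil _ _,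
    featureProj (fun r l => A (g r) (e l)) (fun r => A₀ (g r)) (fun r => β (g r))
      (fun i r => C i (g r))⟩, fun p θ i => ?_⟩
  simp only [NeuralOperator.eval, List.foldl_cons, List.foldl_nil, eval_featureLift,
    eval_featureProj, eval_featureLayer hσ]
  rw [← hsumT]
  simp only [← hsumS]

/-- The preactivations of the projection network, as functions on `K × [-D, 0]`: the position
(for `none`) and the features. -/
noncomputable def featureMap {σ : ℝ → ℝ} (hσ : Continuous σ) {K : Set (Vec n × C1 D m)}
    (hK : IsCompact K) : Option (Feature (n + m)) → C(K × Icc (-D) 0, ℝ)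
  | none => ⟨fun z => z.2, by fun_prop⟩
  | some φ => ⟨fun z => φ.eval σ (inputFunction z.1.1),
      (φ.continuous_eval hσ hK).comp continuous_fst⟩

/-- Finitely many elements of the ridge span over the features are described by common finite sets
of neurons and features. -/
lemma exists_sum_of_mem_ridgeSpan {σ : C(ℝ, ℝ)} {K : Set (Vec n × C1 D m)} (hK : IsCompact K)
    {k : ℕ} (h : Fin k → C(K × Icc (-D) 0, ℝ))
    (hh : ∀ i, h i ∈ ridgeSpan σ (Submodule.span ℝ (range (featureMap σ.continuous hK)))) :
    ∃ (τ : Type) (S : Finset (Feature (n + m))) (T : Finset τ) (A : τ → Feature (n + m) → ℝ)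
      (A₀ β : τ → ℝ) (C : Fin k → τ → ℝ), S.Nonempty ∧
      ∀ i z, h i z = ∑ r ∈ T, C i r *
        σ (∑ φ ∈ S, A r φ * φ.eval σ (inputFunction z.1.1) + A₀ r * z.2 + β r) := by
  classical
  choose c hc using fun i => Finsupp.mem_span_range_iff_exists_finsupp.mp (hh i)
  choose e he using fun r : Submodule.span ℝ (range (featureMap σ.continuous hK)) × ℝ =>
    Finsupp.mem_span_range_iff_exists_finsupp.mp r.1.2
  let T := Finset.univ.biUnion fun i => (c i).support
  -- The default feature is included because an operator needs at least one channel.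
  let S := insert default (T.biUnion fun r => (e r).support.eraseNone)
  refine ⟨_, S, T, fun r φ => e r (some φ), fun r => e r none, fun r => r.2, fun i r => c i r,
    Finset.insert_nonempty _ _, fun i z => ?_⟩
  have hpre : ∀ r ∈ T, (r.1 : C(K × Icc (-D) 0, ℝ)) z =
      ∑ φ ∈ S, e r (some φ) * φ.eval σ (inputFunction z.1.1) + e r none * z.2 := by
    intro r hr
    have hsub : (e r).support ⊆ S.insertNone := fun o ho => by
      cases o with
      | none => simp
      | some φ =>
        rw [Finset.some_mem_insertNone]
        exact Finset.mem_insert_of_mem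
          (Finset.mem_biUnion.mpr ⟨r, hr, Finset.mem_eraseNone.mpr ho⟩)
    rw [← he r, Finsupp.sum_of_support_subset _ hsub _ (by simp), ContinuousMap.sum_apply,
      Finset.sum_insertNone, add_comm]
    simp [featureMap]
  rw [← hc i, Finsupp.sum_of_support_subset (c i)
    (Finset.subset_biUnion_of_mem (fun i => (c i).support) (Finset.mem_univ i)) _ (by simp),
    ContinuousMap.sum_apply]
  refine Finset.sum_congr rfl fun r hr => ?_
  rw [← hpre r hr]
  simp

end Features

end DelayPredictor

/-! ### Approximation of the predictor -/

open DelayPredictor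
theorem mainTheorem2 {n m : ℕ} {D : ℝ} (hD : 0 < D)
    (f : Vec n → Vec m → Vec n) (hf : LipschitzDynamics f) (hfc : ForwardComplete f)
    (σ : ℝ → ℝ) (hσ : IsActivation σ) :
    (∀ (X : Vec n) (U : C1 D m),
      ∃! P : C1 D n, IsPredictor f X U P) ∧
    ∀ (𝒳 : Set (Vec n)) (𝒰 : Set (Vec m)),
      Bornology.IsBounded 𝒳 → Bornology.IsBounded 𝒰 →
      ∀ K : Set (Vec n × C1 D m), IsCompact K →
        (∀ p ∈ K, p.1 ∈ 𝒳 ∧ ∀ θ, p.2.1 θ ∈ 𝒰) →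
        ∀ ε : ℝ, 0 < ε →
          ∃ Phat : K → C1 D n, IsNeuralOperator σ Phat ∧
            (⨆ (p : K) (θ : Icc (-D) 0), edist ((predictor f p.1).1 θ) ((Phat p).1 θ))
              < ENNReal.ofReal ε := by
  refine ⟨fun X U => ?_, fun _ _ _ _ K hK _ ε hε => ?_⟩
  · obtain ⟨P, hP⟩ := exists_isPredictor hf hfc hD.le X U
    exact ⟨P, hP, fun Q hQ => IsPredictor.unique hf hD.le hQ hP⟩
  have : CompactSpace K := isCompact_iff_compactSpace.mp hK
  let σc : C(ℝ, ℝ) := ⟨σ, hσ.continuous⟩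
  let V := Submodule.span ℝ (range (featureMap σc.continuous hK))
  have hsep : ∀ x y : K × Icc (-D) 0, x ≠ y → ∃ a ∈ V, a x ≠ a y := by
    intro x y hxy
    by_cases h : x.2 = y.2
    · have h1 : x.1.1 ≠ y.1.1 := fun h1 => hxy (Prod.ext (Subtype.ext h1) h)
      obtain ⟨φ, hφ⟩ := exists_feature_ne hσ hD h1
      exact ⟨_, Submodule.subset_span ⟨some φ, rfl⟩, hφ⟩
    · exact ⟨_, Submodule.subset_span ⟨none, rfl⟩, fun h1 => h (Subtype.ext h1)⟩
  have hcont : ∀ i, Continuous fun z : K × Icc (-D) 0 => (predictor f z.1.1).1 z.2 i := by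
    intro i
    have h1 : Continuous fun z : K × Icc (-D) 0 => (predictor f z.1.1).1 z.2 :=
      continuous_eval.comp (((continuous_predictor hf hfc hD.le).comp
        (continuous_subtype_val.comp continuous_fst)).prodMk continuous_snd)
    exact (EuclideanSpace.proj i).continuous.comp h1
  -- An error `ε / (2 (n + 1))` in each of `n` coordinates gives an error of at most `ε / 2`.
  have hδ : 0 < ε / (2 * (n + 1)) := by positivity
  choose h hh hnear using fun i =>
    exists_mem_ridgeSpan_near σc hσ V hsep ⟨_, hcont i⟩ hδ
  obtain ⟨τ, S, T, A, A₀, β, C, hS, hsum⟩ := exists_sum_of_mem_ridgeSpan hK h hh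
  obtain ⟨N, hN⟩ := exists_neuralOperator_eval_eq (D := D) hσ.continuous S T A A₀ β C hS
  let G : K → ℝ → Vec n := fun p t => WithLp.toLp 2 fun i => ∑ r ∈ T, C i r *
    σ (∑ φ ∈ S, A r φ * φ.eval σ (inputFunction p.1) + A₀ r * t + β r)
  have hG : ∀ p, ContDiff ℝ 1 (G p) := by
    intro p
    rw [contDiff_euclidean]
    intro i
    refine ContDiff.sum fun r _ => contDiff_const.mul ?_
    exact (hσ.smooth.of_le (mod_cast le_top)).comp (by fun_prop)
  let Phat : K → C1 D n := fun p =>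
    ⟨⟨fun θ => G p θ, (hG p).continuous.comp continuous_subtype_val⟩, G p, (hG p).contDiffOn,
      fun _ => rfl⟩
  refine ⟨Phat, ⟨N, fun p θ i => (hN p.1 θ i).symm⟩, ?_⟩
  refine (iSup₂_le fun p θ => ?_).trans_lt
    ((ENNReal.ofReal_lt_ofReal_iff hε).mpr (half_lt_self hε))
  rw [edist_dist]
  refine ENNReal.ofReal_le_ofReal ?_
  rw [EuclideanSpace.dist_eq]
  refine Real.sqrt_le_iff.mpr ⟨by positivity, ?_⟩
  have hcoord : ∀ i, dist ((predictor f p.1).1 θ i) ((Phat p).1 θ i) ^ 2 ≤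
      (ε / (2 * (n + 1))) ^ 2 := by
    intro i
    refine pow_le_pow_left₀ dist_nonneg ?_ 2
    have h1 : (Phat p).1 θ i = h i (p, θ) := (hsum i (p, θ)).symm
    rw [h1, Real.dist_eq]
    exact (hnear i (p, θ)).le
  calc ∑ i, dist ((predictor f p.1).1 θ i) ((Phat p).1 θ i) ^ 2
      ≤ ∑ _i : Fin n, (ε / (2 * (n + 1))) ^ 2 := Finset.sum_le_sum fun i _ => hcoord i
    _ = n * (ε / (2 * (n + 1))) ^ 2 := by simp
    _ ≤ (n + 1) ^ 2 * (ε / (2 * (n + 1))) ^ 2 := by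
        refine mul_le_mul_of_nonneg_right ?_ (sq_nonneg _)
        nlinarith [(Nat.cast_nonneg n : (0 : ℝ) ≤ n)]
    _ = (ε / 2) ^ 2 := by
        field_simp
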